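/- Let $k\ge 0$ and $n$ be integers with $m = n-2-k > 2$, let $X$ be a real $n\times(2+k)$ matrix of full column rank, $\beta=(\beta_0,\beta_1,\dots,\beta_{1+k})'\in\mathbb R^{2+k}$, $\sigma>0$, and let $Y = X\beta+\varepsilon$ with $\varepsilon\sim N(0,\sigma^2 I_n)$ (in the intended application the first column of $X$ consists of ones and the second is the $0/1$ group indicator). Write $d=\beta_1/\sigma$, let $e$ be the unit vector in $\mathbb R^{2+k}$ at the position of $\beta_1$, and put $$\widehat\beta=(X'X)^{-1}X'Y,\quad \widehat\sigma^2=\tfrac1m (Y-X\widehat\beta)'(Y-X\widehat\beta),\quad \widehat d=\frac{\widehat\beta_1}{\sqrt{\widehat\sigma^2}},\quad v_1^2=e'(X'X)^{-1}e,\quad c(m)=\frac{\Gamma((m-1)/2)\sqrt{m/2}}{\Gamma(m/2)} .$$ Then the estimator $\widehat d_u=c(m)^{-1}\,\widehat d$ has the following properties. 1. $\widehat d_u$ is integrable and unbiased for $d$: $\mathrm E(\widehat d_u)=d$. 2. $\widehat d_u$ is square integrable and $$\mathrm{Var}(\widehat d_u)=\frac{m\,c(m)^{-2}}{m-2}\,v_1^2+\Big(\frac{m\,c(m)^{-2}}{m-2}-1\Big)d^2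 .$$ 3. The standard error of $\widehat d_u$, that is, the square root of $\mathrm{Var}(\widehat d_u)$ with $d$ replaced by $\widehat d_u$ (for given data, the standard deviation of $\widehat d_u$ under the model at any parameters $(\beta^*,\sigma^*)$, $\sigma^*>0$, with $\beta_1^*/\sigma^*$ equal to the observed value of $\widehat d_u$), is $$\mathrm{se}(\widehat d_u)=\sqrt{\frac{m\,c(m)^{-2}}{m-2}\,v_1^2+\Big(\frac{m\,c(m)^{-2}}{m-2}-1\Big)\widehat d_u^{\,2}} .$$ 4. If $k=0$, the first column of $X$ consists of ones and the second column has entries in $\{0,1\}$, then $\widehat d_u$ is Hedges' $g$ of the two groups, $$\widehat d_u = c(n_0+n_1-2)^{-1}\,\frac{\overline Y_1-\overline Y_0}{S},\qquad S=\sqrt{\frac{Q_0+Q_1}{n_0+n_1-2}},$$ where, for $j=0,1$, $n_j$, $\overline Y_j$ and $Q_j$ are the size, the sample mean and the sum of squared deviations from the sample mean of the observations whose second-column entry is $j$. (Where a denominator $\sqrt{\widehat\sigma^2}$ or $S$ vanishes, the quotient is set to $0$; this is an event of probability zero.) -/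

import Mathlib

open MeasureTheory ProbabilityTheory Matrix

noncomputable section

namespace CohenD

/-- The constant `c(m) = Γ((m-1)/2) √(m/2) / Γ(m/2)`. -/
def c (m : ℝ) : ℝ := Real.Gamma ((m - 1) / 2) * Real.sqrt (m / 2) / Real.Gamma (m / 2)

/-- The residual degrees of freedom `m = n - 2 - k`, as a real number (no truncation). -/
def dof (n k : ℕ) : ℝ := (n : ℝ) - 2 - (k : ℝ)

variable {n k : ℕ}

/-- The least squares estimator `(X'X)⁻¹ X' y` of the coefficients `β₀, β₁, …, β_{k+1}`
(coordinate `1` is the group coefficient `β₁`). -/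
def betaHat (X : Matrix (Fin n) (Fin (k + 2)) ℝ) (y : EuclideanSpace ℝ (Fin n)) :
    Fin (k + 2) → ℝ :=
  ((Xᵀ * X)⁻¹ * Xᵀ) *ᵥ y.ofLp

/-- The residual vector `y - X β̂`. -/
def residual (X : Matrix (Fin n) (Fin (k + 2)) ℝ) (y : EuclideanSpace ℝ (Fin n)) :
    Fin n → ℝ :=
  y.ofLp - X *ᵥ betaHat X y

/-- The usual variance estimator `σ̂² = m⁻¹ (y - X β̂)'(y - X β̂)`. -/
def sigmaSqHat (X : Matrix (Fin n) (Fin (k + 2)) ℝ) (y : EuclideanSpace ℝ (Fin n)) : ℝ :=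
  (dof n k)⁻¹ * (residual X y ⬝ᵥ residual X y)

/-- The generalized Cohen estimator `d̂ = β̂₁ / √σ̂²`. -/
def dHat (X : Matrix (Fin n) (Fin (k + 2)) ℝ) (y : EuclideanSpace ℝ (Fin n)) : ℝ :=
  betaHat X y 1 / Real.sqrt (sigmaSqHat X y)

/-- The corrected estimator `d̂ᵤ = c(m)⁻¹ d̂`. -/
def dHatU (X : Matrix (Fin n) (Fin (k + 2)) ℝ) (y : EuclideanSpace ℝ (Fin n)) : ℝ :=
  (c (dof n k))⁻¹ * dHat X y

/-- `v₁² = e'(X'X)⁻¹e`, where `e` is the unit vector at the position of `β₁`. -/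
def v1Sq (X : Matrix (Fin n) (Fin (k + 2)) ℝ) : ℝ :=
  (Pi.single 1 1 : Fin (k + 2) → ℝ) ⬝ᵥ ((Xᵀ * X)⁻¹ *ᵥ (Pi.single 1 1 : Fin (k + 2) → ℝ))

/-- The population effect size `d = β₁ / σ`. -/
def effectSize (β : Fin (k + 2) → ℝ) (σ : ℝ) : ℝ := β 1 / σ

/-- The law `N(Xβ, σ² Iₙ)` of the observation vector in the linear model. -/
def modelLaw (X : Matrix (Fin n) (Fin (k + 2)) ℝ) (β : Fin (k + 2) → ℝ) (σ : ℝ) :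
    Measure (EuclideanSpace ℝ (Fin n)) :=
  multivariateGaussian (WithLp.toLp 2 (X *ᵥ β)) (σ ^ 2 • (1 : Matrix (Fin n) (Fin n) ℝ))

/-- The statistic `s` is the standard error of `d̂ᵤ`, i.e. the square root of `var(d̂ᵤ)` with the
unknown `d` replaced by `d̂ᵤ`: at data `y`, it is the standard deviation that `d̂ᵤ` has under
the model at every parameter point `(β, σ)` whose effect size equals `d̂ᵤ(y)`. -/
def IsStandardError (X : Matrix (Fin n) (Fin (k + 2)) ℝ)
    (s : EuclideanSpace ℝ (Fin n) → ℝ) : Prop :=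
  ∀ (y : EuclideanSpace ℝ (Fin n)) (β : Fin (k + 2) → ℝ) (σ : ℝ), 0 < σ →
    effectSize β σ = dHatU X y → s y = Real.sqrt (variance (dHatU X) (modelLaw X β σ))

/-- The sample mean of the observations `y i`, `i ∈ G`. -/
def groupMean (G : Finset (Fin n)) (y : EuclideanSpace ℝ (Fin n)) : ℝ :=
  (∑ i ∈ G, y i) / (G.card : ℝ)

/-- The sum of squared differences from the sample mean over the group `G`. -/
def groupSS (G : Finset (Fin n)) (y : EuclideanSpace ℝ (Fin n)) : ℝ :=
  ∑ i ∈ G, (y i - groupMean G y) ^ 2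

/-- The classical Cohen's `d` for two groups: `(Ȳ₁ - Ȳ₀) / S` with
`S = √((Q₀ + Q₁) / (n₀ + n₁ - 2))`. -/
def classicalCohenD (G₀ G₁ : Finset (Fin n)) (y : EuclideanSpace ℝ (Fin n)) : ℝ :=
  (groupMean G₁ y - groupMean G₀ y) /
    Real.sqrt ((groupSS G₀ y + groupSS G₁ y) / ((G₀.card : ℝ) + (G₁.card : ℝ) - 2))

/-- Hedges' `g` for two groups: the classical Cohen's `d` divided by `c(n₀ + n₁ - 2)`. -/
def hedgesG (G₀ G₁ : Finset (Fin n)) (y : EuclideanSpace ℝ (Fin n)) : ℝ :=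
  (c ((G₀.card : ℝ) + (G₁.card : ℝ) - 2))⁻¹ * classicalCohenD G₀ G₁ y

end CohenD

end

/-!
The law `N(Xβ, σ² I)` is the image of the standard Gaussian measure under `z ↦ Xβ + σz`. At this
point the least squares coefficient is `β₁ + σ⟪w, z⟫`, where `w = X(X'X)⁻¹e` lies in the column
space of `X` and `‖w‖² = v₁²`, and the residual vector is `σ` times the projection `Pz` of `z` onto
the orthogonal complement of the column space, which has dimension `m`. Hence
`d̂ = √m (d + ⟪w, z⟫) / ‖Pz‖` (`CohenD.dHat_model`).

Since `w` is orthogonal to the range of `P`, the numerator and `Pz` are independent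
(`indepFun_inner_orthogonalProjection_stdGaussian`), and `Pz` is a standard Gaussian vector in
dimension `m`. So the first two moments of `d̂` factor into the moments `d` and `d² + v₁²` of the
numerator and the negative moments `E ‖Pz‖⁻¹ = Γ((m-1)/2) / (√2 Γ(m/2))` and
`E ‖Pz‖⁻² = 1 / (m - 2)`. The latter are computed in polar coordinates from the Gaussian density
(`moment_norm_stdGaussian`); they give `E d̂ = c(m) d` and `E d̂² = m (d² + v₁²) / (m - 2)`.

The formula for the standard error is the variance formula at a parameter point whose effect size
is the observed value of the estimator. In the two-group design the normal equations are solved by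
the mean of group `0` and the difference of the group means, which turns the estimator into
Hedges' `g`.
-/

/-! ### The standard Gaussian measure: density and moments of the norm -/

open Module in
/-- Both sides have the same characteristic function. -/
theorem stdGaussian_eq_withDensity (E : Type*) [NormedAddCommGroup E] [InnerProductSpace ℝ E]
    [FiniteDimensional ℝ E] [MeasurableSpace E] [BorelSpace E] :
    stdGaussian E = volume.withDensity fun x => ENNReal.ofReal
      ((2 * Real.pi) ^ (-(finrank ℝ E : ℝ) / 2) * Real.exp (-(1 / 2) * ‖x‖ ^ 2)) := by
  have hb : 0 < ((1 / 2 : ℂ)).re := by norm_num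
  have hint : Integrable (fun x : E => (2 * Real.pi) ^ (-(finrank ℝ E : ℝ) / 2) *
      Real.exp (-(1 / 2) * ‖x‖ ^ 2)) := by
    refine Integrable.const_mul ?_ _
    have h := (GaussianFourier.integrable_cexp_neg_mul_sq_norm_add hb 0 (0 : E)).re
    refine h.congr (Filter.Eventually.of_forall fun x => ?_)
    simp only [zero_mul, add_zero, RCLike.re_to_complex]
    rw [show (-(1 / 2 : ℂ) * (‖x‖ : ℂ) ^ 2) = ((-(1 / 2) * ‖x‖ ^ 2 : ℝ) : ℂ) by push_cast; ring,
      Complex.exp_ofReal_re]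
  have := isFiniteMeasure_withDensity_ofReal hint.2
  apply Measure.ext_of_charFun
  ext t
  rw [charFun_stdGaussian, charFun_apply, integral_withDensity_eq_integral_toReal_smul
    (by fun_prop) (by simp)]
  have h2 : ((2 * Real.pi : ℝ) : ℂ) ≠ 0 := by
    exact_mod_cast (by positivity : (2 * Real.pi : ℝ) ≠ 0)
  have h := GaussianFourier.integral_cexp_neg_mul_sq_norm_add hb Complex.I t
  calc Complex.exp (-‖t‖ ^ 2 / 2)
      = (((2 * Real.pi) ^ (-(finrank ℝ E : ℝ) / 2) : ℝ) : ℂ) *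
          ∫ v : E, Complex.exp (-(1 / 2) * ‖v‖ ^ 2 + Complex.I * inner ℝ t v) := by
        rw [h, Complex.ofReal_cpow (by positivity), ← mul_assoc,
          show (Real.pi : ℂ) / (1 / 2) = ((2 * Real.pi : ℝ) : ℂ) by push_cast; ring,
          ← Complex.cpow_add _ _ h2]
        push_cast
        rw [show -(finrank ℝ E : ℂ) / 2 + finrank ℝ E / 2 = 0 by ring, Complex.cpow_zero, one_mul,
          Complex.I_sq]
        congr 1
        ring
    _ = _ := by
        rw [← integral_const_mul]
        congr 1 with x
        rw [ENNReal.toReal_ofReal (by positivity), Complex.real_smul, Complex.exp_add,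
          real_inner_comm]
        push_cast
        ring_nf

open Module in
/-- Moments of the chi distribution, of negative order included. Integration in polar coordinates
reduces them to Gamma integrals. -/
theorem moment_norm_stdGaussian {E : Type*} [NormedAddCommGroup E] [InnerProductSpace ℝ E]
    [FiniteDimensional ℝ E] [MeasurableSpace E] [BorelSpace E] [Nontrivial E] {p : ℝ}
    (hp : 0 < finrank ℝ E + p) :
    Integrable (fun x : E => ‖x‖ ^ p) (stdGaussian E) ∧
    ∫ x : E, ‖x‖ ^ p ∂(stdGaussian E) =
      2 ^ (p / 2) * Real.Gamma ((finrank ℝ E + p) / 2) / Real.Gamma (finrank ℝ E / 2) := by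
  have hn : 0 < finrank ℝ E := finrank_pos
  have hn' : (1 : ℝ) ≤ finrank ℝ E := by exact_mod_cast hn
  set a : ℝ := (2 * Real.pi) ^ (-(finrank ℝ E : ℝ) / 2)
  have hrad : ∀ q : ℝ, ∀ y ∈ Set.Ioi (0 : ℝ),
      y ^ (finrank ℝ E - 1) • (a * Real.exp (-(1 / 2) * y ^ 2) * y ^ q) =
        a * (y ^ (finrank ℝ E - 1 + q : ℝ) * Real.exp (-(1 / 2) * y ^ (2 : ℝ))) := by
    intro q y hy
    have hcast : (finrank ℝ E : ℝ) - 1 = ((finrank ℝ E - 1 : ℕ) : ℝ) := by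
      rw [Nat.cast_sub hn, Nat.cast_one]
    rw [Real.rpow_add hy, hcast, Real.rpow_natCast, Real.rpow_two, smul_eq_mul]
    ring
  have key : ∀ q : ℝ, 0 < finrank ℝ E + q →
      Integrable (fun x : E => ‖x‖ ^ q) (stdGaussian E) ∧
      ∫ x : E, ‖x‖ ^ q ∂(stdGaussian E) =
        finrank ℝ E • (volume : Measure E).real (Metric.ball 0 1) •
          (a * ((1 / 2 : ℝ) ^ (-(finrank ℝ E + q) / 2) * (1 / 2) *
            Real.Gamma ((finrank ℝ E + q) / 2))) := by
    intro q hq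
    have hq' : (-1 : ℝ) < finrank ℝ E - 1 + q := by linarith
    rw [stdGaussian_eq_withDensity]
    constructor
    · rw [integrable_withDensity_iff_integrable_smul' (by fun_prop) (by simp)]
      simp only [smul_eq_mul]
      have : IntegrableOn (fun y : ℝ => y ^ (finrank ℝ E - 1) •
          (a * Real.exp (-(1 / 2) * y ^ 2) * y ^ q)) (Set.Ioi 0) := by
        rw [integrableOn_congr_fun (hrad q) measurableSet_Ioi]
        exact (integrableOn_rpow_mul_exp_neg_mul_rpow hq' two_pos (by norm_num)).const_mul _
      refine ((integrable_fun_norm_addHaar (volume : Measure E)).2 this).congr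
        (Filter.Eventually.of_forall fun x => ?_)
      simp only
      rw [ENNReal.toReal_ofReal (by positivity)]
    · rw [integral_withDensity_eq_integral_toReal_smul (by fun_prop) (by simp)]
      have h := integral_fun_norm_addHaar (volume : Measure E)
        (fun y : ℝ => a * Real.exp (-(1 / 2) * y ^ 2) * y ^ q)
      rw [setIntegral_congr_fun measurableSet_Ioi (hrad q), integral_const_mul,
        integral_rpow_mul_exp_neg_mul_rpow two_pos hq' (by norm_num)] at h
      rw [show (finrank ℝ E : ℝ) + q = finrank ℝ E - 1 + q + 1 by ring, ← h]
      congr 1 with x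
      rw [ENNReal.toReal_ofReal (by positivity), smul_eq_mul]
  refine ⟨(key p hp).1, ?_⟩
  -- The case `q = 0` determines the normalising constant.
  have h0 := (key 0 (by linarith)).2
  rw [(key p hp).2]
  simp only [Real.rpow_zero, integral_const, probReal_univ, smul_eq_mul, mul_one, add_zero,
    nsmul_eq_mul] at h0 ⊢
  have hG : Real.Gamma ((finrank ℝ E : ℝ) / 2) ≠ 0 := (Real.Gamma_pos_of_pos (by positivity)).ne'
  have hpow : (1 / 2 : ℝ) ^ (-(p / 2)) = 2 ^ (p / 2) := by
    rw [one_div, Real.inv_rpow two_pos.le, Real.rpow_neg two_pos.le, inv_inv]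
  rw [eq_div_iff hG, show -((finrank ℝ E : ℝ) + p) / 2 = -(finrank ℝ E : ℝ) / 2 + -(p / 2) by ring,
    Real.rpow_add (by norm_num), hpow]
  linear_combination (-(2 ^ (p / 2) * Real.Gamma ((finrank ℝ E + p) / 2))) * h0

/-! ### Orthogonal projections of a standard Gaussian vector -/

theorem map_orthogonalProjection_stdGaussian {E : Type*} [NormedAddCommGroup E]
    [InnerProductSpace ℝ E] [FiniteDimensional ℝ E] [MeasurableSpace E] [BorelSpace E]
    (K : Submodule ℝ E) :
    (stdGaussian E).map K.orthogonalProjectionOnto = stdGaussian K := by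
  have : IsProbabilityMeasure ((stdGaussian E).map K.orthogonalProjectionOnto) :=
    Measure.isProbabilityMeasure_map (by fun_prop)
  apply Measure.ext_of_charFun
  ext t
  rw [charFun_stdGaussian, charFun_apply, integral_map (by fun_prop)
    (Measurable.aestronglyMeasurable (by fun_prop))]
  simp_rw [Submodule.inner_orthogonalProjectionOnto_eq_of_mem_right]
  rw [← charFun_apply, charFun_stdGaussian]
  simp

/-- A coordinate along `w ⟂ K` is uncorrelated with the projection onto `K`, hence independent of
it, because the two are jointly Gaussian. -/
theorem indepFun_inner_orthogonalProjection_stdGaussian {E : Type*} [NormedAddCommGroup E]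
    [InnerProductSpace ℝ E] [FiniteDimensional ℝ E] [MeasurableSpace E] [BorelSpace E]
    (K : Submodule ℝ E) {w : E} (hw : w ∈ Kᗮ) :
    IndepFun (fun x => inner ℝ w x) (fun x => K.orthogonalProjectionOnto x) (stdGaussian E) := by
  have hG : HasGaussianLaw (fun x : E => (inner ℝ w x, K.orthogonalProjectionOnto x))
      (stdGaussian E) :=
    (IsGaussian.hasGaussianLaw_id (μ := stdGaussian E)).map_fun
      ((innerSL ℝ w).prod K.orthogonalProjectionOnto)
  refine hG.indepFun_of_covariance_inner fun r u => ?_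
  have h1 : (fun x : E => inner ℝ r (inner ℝ w x)) = fun x => inner ℝ (r • w) x := by
    ext x
    simp [real_inner_smul_left, mul_comm]
  have h2 : (fun x : E => inner ℝ u (K.orthogonalProjectionOnto x)) = fun x => inner ℝ (u : E) x := by
    ext x
    rw [real_inner_comm, Submodule.inner_orthogonalProjectionOnto_eq_of_mem_right, real_inner_comm]
  rw [h1, h2, ← covarianceBilin_apply_eq_cov IsGaussian.memLp_two_id, covarianceBilin_stdGaussian,
    innerSL_apply_apply, real_inner_smul_left,
    Submodule.inner_left_of_mem_orthogonal u.2 hw, mul_zero]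

theorem moments_inner_stdGaussian {E : Type*} [NormedAddCommGroup E]
    [InnerProductSpace ℝ E] [FiniteDimensional ℝ E] [MeasurableSpace E] [BorelSpace E]
    (w : E) (d : ℝ) :
    MemLp (fun x => d + inner ℝ w x) 2 (stdGaussian E) ∧
    ∫ x, (d + inner ℝ w x) ∂(stdGaussian E) = d ∧
    ∫ x, (d + inner ℝ w x) ^ 2 ∂(stdGaussian E) = d ^ 2 + ‖w‖ ^ 2 := by
  have hG : HasGaussianLaw (fun x : E => innerSL ℝ w x) (stdGaussian E) :=
    (IsGaussian.hasGaussianLaw_id (μ := stdGaussian E)).map_fun (innerSL ℝ w)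
  have h0 : ∫ x, inner ℝ w x ∂(stdGaussian E) = 0 := integral_strongDual_stdGaussian (innerSL ℝ w)
  have hL : MemLp (fun x : E => inner ℝ w x) 2 (stdGaussian E) := hG.memLp_two
  have hD : MemLp (fun x : E => d + inner ℝ w x) 2 (stdGaussian E) := (memLp_const d).add hL
  have hI : ∫ x, (d + inner ℝ w x) ∂(stdGaussian E) = d := by
    rw [integral_add (integrable_const d) (hL.integrable one_le_two), h0]
    simp
  refine ⟨hD, hI, ?_⟩
  have hV : Var[fun x => d + inner ℝ w x; stdGaussian E] = ‖w‖ ^ 2 := by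
    rw [variance_const_add hL.aestronglyMeasurable]
    have := variance_dual_stdGaussian (innerSL ℝ w)
    rwa [innerSL_apply_norm] at this
  rw [variance_eq_sub hD, hI] at hV
  simp only [Pi.pow_apply] at hV
  linarith

open Module in
/-- First two moments of a shifted Gaussian coordinate divided by the norm of an orthogonal Gaussian
projection: up to scaling, those of the noncentral t distribution. The numerator and the
denominator are independent, so the moments factor. `2 < finrank ℝ K` makes the second one finite. -/
theorem moments_noncentralT {E : Type*} [NormedAddCommGroup E]
    [InnerProductSpace ℝ E] [FiniteDimensional ℝ E] [MeasurableSpace E] [BorelSpace E]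
    (K : Submodule ℝ E) (hK : 2 < finrank ℝ K) {w : E} (hw : w ∈ Kᗮ) (d : ℝ) :
    MemLp (fun x => (d + inner ℝ w x) * ‖K.orthogonalProjectionOnto x‖⁻¹) 2 (stdGaussian E) ∧
    ∫ x, (d + inner ℝ w x) * ‖K.orthogonalProjectionOnto x‖⁻¹ ∂(stdGaussian E) =
      d * (Real.Gamma ((finrank ℝ K - 1 : ℝ) / 2) /
        (Real.sqrt 2 * Real.Gamma ((finrank ℝ K : ℝ) / 2))) ∧
    ∫ x, ((d + inner ℝ w x) * ‖K.orthogonalProjectionOnto x‖⁻¹) ^ 2 ∂(stdGaussian E) =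
      (d ^ 2 + ‖w‖ ^ 2) * (finrank ℝ K - 2 : ℝ)⁻¹ := by
  have : Nontrivial K := nontrivial_of_finrank_pos (by omega : 0 < finrank ℝ K)
  have hK' : (2 : ℝ) < finrank ℝ K := by exact_mod_cast hK
  obtain ⟨hU, hU1, hU2⟩ := moments_inner_stdGaussian w d
  have hmap := map_orthogonalProjection_stdGaussian K
  have hV (p : ℝ) (hp : 0 < finrank ℝ K + p) :
      Integrable (fun x => ‖K.orthogonalProjectionOnto x‖ ^ p) (stdGaussian E) ∧
      ∫ x, ‖K.orthogonalProjectionOnto x‖ ^ p ∂(stdGaussian E) =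
        2 ^ (p / 2) * Real.Gamma ((finrank ℝ K + p) / 2) / Real.Gamma (finrank ℝ K / 2) := by
    have h := moment_norm_stdGaussian (E := K) hp
    rw [← hmap, integral_map (by fun_prop) (Measurable.aestronglyMeasurable (by fun_prop)),
      integrable_map_measure (Measurable.aestronglyMeasurable (by fun_prop)) (by fun_prop)] at h
    exact h
  obtain ⟨hV1, hV1'⟩ := hV (-1) (by linarith)
  obtain ⟨hV2, hV2'⟩ := hV (-2) (by linarith)
  have hinv2 (r : ℝ) (hr : 0 ≤ r) : r ^ (-2 : ℝ) = r⁻¹ ^ 2 := by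
    rw [Real.rpow_neg hr, Real.rpow_two, inv_pow]
  simp only [Real.rpow_neg_one] at hV1 hV1'
  simp only [hinv2 _ (norm_nonneg _)] at hV2 hV2'
  have hind := indepFun_inner_orthogonalProjection_stdGaussian K hw
  have hind1 : IndepFun (fun x => d + inner ℝ w x) (fun x => ‖K.orthogonalProjectionOnto x‖⁻¹)
      (stdGaussian E) :=
    hind.comp (φ := fun r => d + r) (ψ := fun u => ‖u‖⁻¹) (by fun_prop) (by fun_prop)
  have hind2 : IndepFun (fun x => (d + inner ℝ w x) ^ 2)
      (fun x => ‖K.orthogonalProjectionOnto x‖⁻¹ ^ 2) (stdGaussian E) :=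
    hind.comp (φ := fun r => (d + r) ^ 2) (ψ := fun u => ‖u‖⁻¹ ^ 2) (by fun_prop) (by fun_prop)
  refine ⟨?_, ?_, ?_⟩
  · rw [memLp_two_iff_integrable_sq (Measurable.aestronglyMeasurable (by fun_prop))]
    simp only [mul_pow]
    exact hind2.integrable_mul hU.integrable_sq hV2
  · rw [hind1.integral_fun_mul_eq_mul_integral hU.aestronglyMeasurable hV1.aestronglyMeasurable,
      hU1, hV1', show (-1 : ℝ) / 2 = -(1 / 2) by ring, Real.rpow_neg two_pos.le,
      ← Real.sqrt_eq_rpow, ← sub_eq_add_neg]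
    field_simp
  · simp only [mul_pow]
    rw [hind2.integral_fun_mul_eq_mul_integral hU.integrable_sq.aestronglyMeasurable
      hV2.aestronglyMeasurable, hU2, hV2']
    have hx : 0 < ((finrank ℝ K : ℝ) + -2) / 2 := by linarith
    rw [show (finrank ℝ K : ℝ) / 2 = ((finrank ℝ K : ℝ) + -2) / 2 + 1 by ring, Real.Gamma_add_one hx.ne',
      show (-2 : ℝ) / 2 = -1 by ring, Real.rpow_neg_one]
    have hG := (Real.Gamma_pos_of_pos hx).ne'
    have : (finrank ℝ K : ℝ) - 2 ≠ 0 := by linarith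
    rw [← sub_eq_add_neg] at hG ⊢
    field_simp

/-! ### The linear model -/

theorem multivariateGaussian_smul_one {ι : Type*} [Fintype ι] [DecidableEq ι]
    (μ : EuclideanSpace ℝ ι) (σ : ℝ) :
    multivariateGaussian μ (σ ^ 2 • (1 : Matrix ι ι ℝ)) =
      (stdGaussian (EuclideanSpace ℝ ι)).map (fun z => μ + σ • z) := by
  have : IsProbabilityMeasure ((stdGaussian (EuclideanSpace ℝ ι)).map (fun z => μ + σ • z)) :=
    Measure.isProbabilityMeasure_map (by fun_prop)
  apply Measure.ext_of_charFun
  ext t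
  rw [charFun_multivariateGaussian (PosSemidef.one.smul (sq_nonneg σ)), charFun_apply,
    integral_map (by fun_prop) (Measurable.aestronglyMeasurable (by fun_prop))]
  simp_rw [inner_add_left, real_inner_smul_left, ← real_inner_smul_right _ _ σ]
  push_cast
  simp_rw [add_mul, Complex.exp_add]
  rw [integral_const_mul, ← charFun_apply, charFun_stdGaussian, ← Complex.exp_add, sub_eq_add_neg,
    real_inner_comm, smul_mulVec, one_mulVec, dotProduct_smul, norm_smul, Real.norm_eq_abs]
  have h1 : t.ofLp ⬝ᵥ t.ofLp = ‖t‖ ^ 2 := by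
    rw [EuclideanSpace.real_norm_sq_eq]
    exact Finset.sum_congr rfl fun i _ => (sq _).symm
  rw [h1]
  congr 2
  have : ((|σ| : ℝ) : ℂ) ^ 2 = (σ : ℂ) ^ 2 := by exact_mod_cast sq_abs σ
  push_cast
  rw [mul_pow, this, smul_eq_mul]
  push_cast
  ring

namespace CohenD
variable {n k : ℕ}

theorem isUnit_det_gram {X : Matrix (Fin n) (Fin (k + 2)) ℝ} (hX : X.rank = k + 2) :
    IsUnit (Xᵀ * X).det := by
  rw [← Matrix.isUnit_iff_isUnit_det, ← Matrix.linearIndependent_cols_iff_isUnit,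
    linearIndependent_iff_card_eq_finrank_span, Fintype.card_fin, Set.finrank,
    ← Matrix.rank_eq_finrank_span_cols, rank_transpose_mul_self, hX]

theorem gram_mulVec_betaHat {X : Matrix (Fin n) (Fin (k + 2)) ℝ} (hX : X.rank = k + 2)
    (y : EuclideanSpace ℝ (Fin n)) : (Xᵀ * X) *ᵥ betaHat X y = Xᵀ *ᵥ y.ofLp := by
  rw [betaHat, mulVec_mulVec, ← Matrix.mul_assoc, Matrix.mul_nonsing_inv _ (isUnit_det_gram hX),
    Matrix.one_mul]

/-- The normal equations characterize the least squares estimator. -/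
theorem betaHat_eq_of_gram_mulVec {X : Matrix (Fin n) (Fin (k + 2)) ℝ} (hX : X.rank = k + 2)
    {y : EuclideanSpace ℝ (Fin n)} {b : Fin (k + 2) → ℝ} (hb : (Xᵀ * X) *ᵥ b = Xᵀ *ᵥ y.ofLp) :
    betaHat X y = b := by
  rw [betaHat, ← mulVec_mulVec, ← hb, mulVec_mulVec,
    Matrix.nonsing_inv_mul _ (isUnit_det_gram hX), one_mulVec]

theorem betaHat_model {X : Matrix (Fin n) (Fin (k + 2)) ℝ} (hX : X.rank = k + 2)
    (β : Fin (k + 2) → ℝ) (σ : ℝ) (z : EuclideanSpace ℝ (Fin n)) :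
    betaHat X (WithLp.toLp 2 (X *ᵥ β) + σ • z) = β + σ • betaHat X z := by
  apply betaHat_eq_of_gram_mulVec hX
  rw [mulVec_add, mulVec_smul, gram_mulVec_betaHat hX, WithLp.ofLp_add, WithLp.ofLp_smul,
    mulVec_add, mulVec_smul, mulVec_mulVec]

theorem residual_model {X : Matrix (Fin n) (Fin (k + 2)) ℝ} (hX : X.rank = k + 2)
    (β : Fin (k + 2) → ℝ) (σ : ℝ) (z : EuclideanSpace ℝ (Fin n)) :
    residual X (WithLp.toLp 2 (X *ᵥ β) + σ • z) = σ • residual X z := by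
  rw [residual, residual, betaHat_model hX, mulVec_add, mulVec_smul, WithLp.ofLp_add,
    WithLp.ofLp_smul, smul_sub]
  abel

/-- The space of residual vectors: the orthogonal complement of the column space of `X`. -/
noncomputable def residualSpace (X : Matrix (Fin n) (Fin (k + 2)) ℝ) :
    Submodule ℝ (EuclideanSpace ℝ (Fin n)) :=
  (LinearMap.range X.toEuclideanLin)ᗮ

/-- The vector `X (X'X)⁻¹ e`, which represents the linear functional `y ↦ β̂₁`. -/
noncomputable def slopeVector (X : Matrix (Fin n) (Fin (k + 2)) ℝ) : EuclideanSpace ℝ (Fin n) :=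
  WithLp.toLp 2 (X *ᵥ ((Xᵀ * X)⁻¹ *ᵥ Pi.single 1 1))

theorem finrank_residualSpace {X : Matrix (Fin n) (Fin (k + 2)) ℝ} (hX : X.rank = k + 2) :
    (Module.finrank ℝ (residualSpace X) : ℝ) = dof n k := by
  have h := (LinearMap.range X.toEuclideanLin).finrank_add_finrank_orthogonal
  rw [toEuclideanLin_eq_toLin_orthonormal, ← X.rank_eq_finrank_range_toLin, hX,
    finrank_euclideanSpace_fin, ← toEuclideanLin_eq_toLin_orthonormal] at h
  have h' : (k : ℝ) + 2 + Module.finrank ℝ (residualSpace X) = n := by exact_mod_cast h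
  rw [dof]
  linarith

theorem slopeVector_mem_orthogonal (X : Matrix (Fin n) (Fin (k + 2)) ℝ) :
    slopeVector X ∈ (residualSpace X)ᗮ :=
  Submodule.le_orthogonal_orthogonal _
    ⟨WithLp.toLp 2 ((Xᵀ * X)⁻¹ *ᵥ Pi.single 1 1), by simp [slopeVector]⟩

theorem inner_slopeVector (X : Matrix (Fin n) (Fin (k + 2)) ℝ) (z : EuclideanSpace ℝ (Fin n)) :
    inner ℝ (slopeVector X) z = betaHat X z 1 := by
  have hT : ((Xᵀ * X)⁻¹)ᵀ = (Xᵀ * X)⁻¹ := by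
    rw [transpose_nonsing_inv, transpose_mul, transpose_transpose]
  rw [EuclideanSpace.inner_eq_star_dotProduct, star_trivial, dotProduct_comm, slopeVector, betaHat,
    mulVec_mulVec, dotProduct_comm, dotProduct_comm, ← vecMul_transpose, ← dotProduct_mulVec,
    transpose_mul, hT, single_one_dotProduct]

theorem norm_slopeVector_sq {X : Matrix (Fin n) (Fin (k + 2)) ℝ} (hX : X.rank = k + 2) :
    ‖slopeVector X‖ ^ 2 = v1Sq X := by
  rw [← real_inner_self_eq_norm_sq, inner_slopeVector, v1Sq, single_one_dotProduct, slopeVector,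
    betaHat_eq_of_gram_mulVec hX (mulVec_mulVec _ _ _).symm]

theorem residual_eq_orthogonalProjection {X : Matrix (Fin n) (Fin (k + 2)) ℝ}
    (hX : X.rank = k + 2) (z : EuclideanSpace ℝ (Fin n)) :
    ((residualSpace X).orthogonalProjectionOnto z : EuclideanSpace ℝ (Fin n)) =
      WithLp.toLp 2 (residual X z) := by
  rw [← Submodule.starProjection_apply]
  refine Submodule.eq_starProjection_of_mem_orthogonal (K := residualSpace X) ?_ ?_
  · rw [residualSpace, Submodule.mem_orthogonal]
    rintro _ ⟨a, rfl⟩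
    rw [EuclideanSpace.inner_eq_star_dotProduct, star_trivial, toLpLin_apply, dotProduct_mulVec,
      residual, sub_vecMul, ← mulVec_transpose, ← mulVec_transpose, mulVec_mulVec,
      gram_mulVec_betaHat hX, sub_self, zero_dotProduct]
  · refine Submodule.le_orthogonal_orthogonal _ ⟨WithLp.toLp 2 (betaHat X z), ?_⟩
    ext i
    simp [residual]

/-- At the observation `Xβ + σz`, the scale `σ` cancels and `d̂` becomes `√m` times a shifted
coordinate over the norm of an orthogonal projection, both of the standard Gaussian vector `z`. If the projection of `z` vanishes, both sides are `0`. -/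
theorem dHat_model (X : Matrix (Fin n) (Fin (k + 2)) ℝ) (hX : X.rank = k + 2)
    (hm : 0 < dof n k) (β : Fin (k + 2) → ℝ) {σ : ℝ} (hσ : 0 < σ)
    (z : EuclideanSpace ℝ (Fin n)) :
    dHat X (WithLp.toLp 2 (X *ᵥ β) + σ • z) = Real.sqrt (dof n k) *
      ((effectSize β σ + inner ℝ (slopeVector X) z) *
        ‖(residualSpace X).orthogonalProjectionOnto z‖⁻¹) := by
  have hn : residual X z ⬝ᵥ residual X z = ‖(residualSpace X).orthogonalProjectionOnto z‖ ^ 2 := by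
    rw [← Submodule.norm_coe, residual_eq_orthogonalProjection hX, EuclideanSpace.real_norm_sq_eq]
    exact Finset.sum_congr rfl fun i _ => (sq _).symm
  have hs : Real.sqrt (sigmaSqHat X (WithLp.toLp 2 (X *ᵥ β) + σ • z)) =
      (Real.sqrt (dof n k))⁻¹ * (σ * ‖(residualSpace X).orthogonalProjectionOnto z‖) := by
    rw [sigmaSqHat, residual_model hX, smul_dotProduct, dotProduct_smul, hn,
      Real.sqrt_mul (inv_nonneg.2 hm.le), Real.sqrt_inv, smul_eq_mul, smul_eq_mul,
      ← Real.sqrt_sq (by positivity : 0 ≤ σ * ‖(residualSpace X).orthogonalProjectionOnto z‖)]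
    ring_nf
  rw [dHat, hs, betaHat_model hX, inner_slopeVector, effectSize, Pi.add_apply, Pi.smul_apply,
    smul_eq_mul, div_eq_mul_inv, mul_inv, mul_inv, inv_inv]
  field_simp

theorem measurable_dHatU (X : Matrix (Fin n) (Fin (k + 2)) ℝ) : Measurable (dHatU X) := by
  have hb : Continuous (betaHat X) := by
    unfold betaHat
    fun_prop
  have hr : Continuous (residual X) := by
    unfold residual
    fun_prop
  have hb1 : Measurable fun y => betaHat X y 1 := (by fun_prop : Continuous _).measurable
  have hs : Measurable (sigmaSqHat X) := by
    unfold sigmaSqHat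
    exact (by fun_prop : Continuous _).measurable
  exact (hb1.div hs.sqrt).const_mul _

/-- The first two moments of the corrected estimator under the model, obtained from those of the
ratio `(d + ⟪w, z⟫) / ‖Pz‖` of a standard Gaussian vector `z`. -/
theorem moments_dHatU (hm : 2 < dof n k) {X : Matrix (Fin n) (Fin (k + 2)) ℝ}
    (hX : X.rank = k + 2) (β : Fin (k + 2) → ℝ) {σ : ℝ} (hσ : 0 < σ) :
    MemLp (dHatU X) 2 (modelLaw X β σ) ∧
    ∫ y, dHatU X y ∂(modelLaw X β σ) = effectSize β σ ∧
    variance (dHatU X) (modelLaw X β σ) =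
      dof n k * (c (dof n k) ^ 2)⁻¹ / (dof n k - 2) * v1Sq X
        + (dof n k * (c (dof n k) ^ 2)⁻¹ / (dof n k - 2) - 1) * effectSize β σ ^ 2 := by
  have hm0 : 0 < dof n k := by linarith
  have hfin := finrank_residualSpace hX
  obtain ⟨h1, h2, h3⟩ := moments_noncentralT (residualSpace X)
    (by have := hfin ▸ hm; exact_mod_cast this) (slopeVector_mem_orthogonal X) (effectSize β σ)
  rw [hfin] at h2 h3
  rw [norm_slopeVector_sq hX] at h3
  have hcpos : 0 < c (dof n k) := by
    have := Real.Gamma_pos_of_pos (by linarith : 0 < (dof n k - 1) / 2)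
    have := Real.Gamma_pos_of_pos (by linarith : 0 < dof n k / 2)
    unfold c
    positivity
  have heq : ∀ z, dHatU X (WithLp.toLp 2 (X *ᵥ β) + σ • z) =
      (c (dof n k))⁻¹ * Real.sqrt (dof n k) *
      ((effectSize β σ + inner ℝ (slopeVector X) z) *
        ‖(residualSpace X).orthogonalProjectionOnto z‖⁻¹) := fun z => by
    rw [dHatU, dHat_model X hX hm0 β hσ, mul_assoc]
  have hmeas := measurable_dHatU X
  have hL : MemLp (dHatU X) 2 (modelLaw X β σ) := by
    rw [modelLaw, multivariateGaussian_smul_one, memLp_map_measure_iff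
      hmeas.aestronglyMeasurable (by fun_prop)]
    simp only [Function.comp_def, heq]
    exact h1.const_mul _
  have hE : ∫ y, dHatU X y ∂(modelLaw X β σ) = effectSize β σ := by
    rw [modelLaw, multivariateGaussian_smul_one, integral_map (by fun_prop)
      hmeas.aestronglyMeasurable]
    simp only [heq]
    rw [integral_const_mul, h2]
    have hc : c (dof n k) = Real.sqrt (dof n k) * (Real.Gamma ((dof n k - 1) / 2) /
        (Real.sqrt 2 * Real.Gamma (dof n k / 2))) := by
      rw [c, Real.sqrt_div hm0.le]
      ring
    rw [mul_comm (effectSize β σ), ← mul_assoc, mul_assoc _ (Real.sqrt _), ← hc,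
      inv_mul_cancel₀ hcpos.ne', one_mul]
  refine ⟨hL, hE, ?_⟩
  have : IsProbabilityMeasure (modelLaw X β σ) := by
    unfold modelLaw
    infer_instance
  rw [variance_eq_sub hL, hE, modelLaw, multivariateGaussian_smul_one, integral_map (by fun_prop)
      (by simp only [Pi.pow_def]; exact (hmeas.pow_const 2).aestronglyMeasurable)]
  simp only [Pi.pow_apply, heq, mul_pow (_ * _)]
  rw [integral_const_mul, h3, mul_pow, Real.sq_sqrt hm0.le]
  ring

end CohenD

/-! ### Two groups -/

namespace CohenD
variable {n : ℕ}

/-- With an intercept and a `0/1` regressor, the fitted values are the group means. -/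
theorem dHatU_eq_hedgesG {X : Matrix (Fin n) (Fin (0 + 2)) ℝ} (hX : X.rank = 0 + 2)
    (h0 : ∀ i, X i 0 = 1) (h1 : ∀ i, X i 1 = 0 ∨ X i 1 = 1) (y : EuclideanSpace ℝ (Fin n)) :
    dHatU X y = hedgesG (Finset.univ.filter fun i => X i 1 = 0)
      (Finset.univ.filter fun i => X i 1 = 1) y := by
  set G₀ := Finset.univ.filter fun i => X i 1 = 0
  set G₁ := Finset.univ.filter fun i => X i 1 = 1
  have split (f : Fin n → ℝ) : ∑ i, f i = ∑ i ∈ G₀, f i + ∑ i ∈ G₁, f i := by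
    have hcompl : Finset.univ.filter (fun i => ¬ X i 1 = 0) = G₁ := by
      refine Finset.filter_congr fun i _ => ?_
      rcases h1 i with h | h <;> simp [h]
    rw [← Finset.sum_filter_add_sum_filter_not Finset.univ (fun i => X i 1 = 0), hcompl]
  have hx0 (i) (hi : i ∈ G₀) : X i 1 = 0 := (Finset.mem_filter.1 hi).2
  have hx1 (i) (hi : i ∈ G₁) : X i 1 = 1 := (Finset.mem_filter.1 hi).2
  have hn : (n : ℝ) = G₀.card + G₁.card := by
    simpa using split fun _ => 1
  -- The normal equations determine the coefficients as the mean of group `0` and the difference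
  -- of the group means, because `X'X = [[n₀ + n₁, n₁], [n₁, n₁]]`.
  have hXX (b : Fin (0 + 2) → ℝ) (i : Fin n) : (X *ᵥ b) i = b 0 + X i 1 * b 1 := by
    simp [mulVec, dotProduct, Fin.sum_univ_two, h0]
  have hfit0 (b : Fin (0 + 2) → ℝ) (i) (hi : i ∈ G₀) : (X *ᵥ b) i = b 0 := by
    rw [hXX, hx0 i hi, zero_mul, add_zero]
  have hfit1 (b : Fin (0 + 2) → ℝ) (i) (hi : i ∈ G₁) : (X *ᵥ b) i = b 0 + b 1 := by
    rw [hXX, hx1 i hi, one_mul]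
  have hT0 (v : Fin n → ℝ) : (Xᵀ *ᵥ v) 0 = ∑ i ∈ G₀, v i + ∑ i ∈ G₁, v i := by
    rw [← split]
    simp [mulVec, dotProduct, h0]
  have hT1 (v : Fin n → ℝ) : (Xᵀ *ᵥ v) 1 = ∑ i ∈ G₁, v i := by
    simp only [mulVec, dotProduct, transpose_apply]
    rw [split, Finset.sum_congr rfl fun i hi => by rw [hx0 i hi, zero_mul],
      Finset.sum_const_zero, zero_add]
    exact Finset.sum_congr rfl fun i hi => by rw [hx1 i hi, one_mul]
  have hnorm (b : Fin (0 + 2) → ℝ) : (Xᵀ * X) *ᵥ b =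
      ![G₀.card * b 0 + G₁.card * (b 0 + b 1), G₁.card * (b 0 + b 1)] := by
    rw [← mulVec_mulVec]
    ext j
    fin_cases j
    · change (Xᵀ *ᵥ _) 0 = _
      rw [hT0, Finset.sum_congr rfl (hfit0 b), Finset.sum_congr rfl (hfit1 b)]
      simp [mul_add]
    · change (Xᵀ *ᵥ _) 1 = _
      rw [hT1, Finset.sum_congr rfl (hfit1 b)]
      simp [mul_add]
  -- Full rank forces both groups to be non-empty.
  have hinj (b : Fin (0 + 2) → ℝ) (hb : (Xᵀ * X) *ᵥ b = 0) : b = 0 := by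
    rw [← betaHat_eq_of_gram_mulVec hX (y := 0) (b := b) (by simp [hb])]
    simp [betaHat]
  have hc0 : (G₀.card : ℝ) ≠ 0 := fun h => by
    have := congrFun (hinj ![1, -1] (by rw [hnorm]; simp [h])) 0
    simp at this
  have hc1 : (G₁.card : ℝ) ≠ 0 := fun h => by
    have := congrFun (hinj ![0, 1] (by rw [hnorm]; simp [h])) 1
    simp at this
  have hbeta : betaHat X y = ![groupMean G₀ y, groupMean G₁ y - groupMean G₀ y] := by
    apply betaHat_eq_of_gram_mulVec hX
    rw [hnorm]
    ext j
    fin_cases j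
    · change _ = (Xᵀ *ᵥ _) 0
      rw [hT0]
      simp [groupMean, mul_div_cancel₀ _ hc0, mul_div_cancel₀ _ hc1]
    · change _ = (Xᵀ *ᵥ _) 1
      rw [hT1]
      simp [groupMean, mul_div_cancel₀ _ hc1]
  have hdof : dof n 0 = (G₀.card : ℝ) + G₁.card - 2 := by
    rw [dof, hn]
    simp
  have hres : residual X y ⬝ᵥ residual X y = groupSS G₀ y + groupSS G₁ y := by
    rw [dotProduct, split, groupSS, groupSS]
    congr 1
    · refine Finset.sum_congr rfl fun i hi => ?_
      rw [residual, Pi.sub_apply, hfit0 _ i hi, hbeta, sq]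
      simp
    · refine Finset.sum_congr rfl fun i hi => ?_
      rw [residual, Pi.sub_apply, hfit1 _ i hi, hbeta, sq]
      simp
  rw [dHatU, hedgesG, classicalCohenD, dHat, sigmaSqHat, hres, hbeta, hdof,
    inv_mul_eq_div ((G₀.card : ℝ) + G₁.card - 2)]
  simp

end CohenD

theorem mainTheorem3 {n k : ℕ} (hm : 2 < CohenD.dof n k)
    (X : Matrix (Fin n) (Fin (k + 2)) ℝ) (hX : X.rank = k + 2)
    (β : Fin (k + 2) → ℝ) (σ : ℝ) (hσ : 0 < σ)
    {Ω : Type*} [MeasurableSpace Ω] (P : Measure Ω)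
    (ε Y : Ω → EuclideanSpace ℝ (Fin n))
    (hε : HasLaw ε (multivariateGaussian 0 (σ ^ 2 • (1 : Matrix (Fin n) (Fin n) ℝ))) P)
    (hY : ∀ ω, Y ω = WithLp.toLp 2 (X *ᵥ β) + ε ω) :
    -- the corrected estimator is unbiased for the effect size
    (Integrable (fun ω => CohenD.dHatU X (Y ω)) P ∧
      ∫ ω, CohenD.dHatU X (Y ω) ∂P = CohenD.effectSize β σ) ∧
    -- its variance
    (MemLp (fun ω => CohenD.dHatU X (Y ω)) 2 P ∧
      variance (fun ω => CohenD.dHatU X (Y ω)) P =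
        CohenD.dof n k * (CohenD.c (CohenD.dof n k) ^ 2)⁻¹ / (CohenD.dof n k - 2)
            * CohenD.v1Sq X
          + (CohenD.dof n k * (CohenD.c (CohenD.dof n k) ^ 2)⁻¹ / (CohenD.dof n k - 2) - 1)
            * CohenD.effectSize β σ ^ 2) ∧
    -- its standard error, the plug-in version of the square root of the variance
    CohenD.IsStandardError X (fun y => Real.sqrt
        (CohenD.dof n k * (CohenD.c (CohenD.dof n k) ^ 2)⁻¹ / (CohenD.dof n k - 2)
            * CohenD.v1Sq X
          + (CohenD.dof n k * (CohenD.c (CohenD.dof n k) ^ 2)⁻¹ / (CohenD.dof n k - 2) - 1)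
            * CohenD.dHatU X y ^ 2)) ∧
    -- without further explanatory variables it is Hedges' g
    (k = 0 → (∀ i, X i 0 = 1) → (∀ i, X i 1 = 0 ∨ X i 1 = 1) →
      ∀ y, CohenD.dHatU X y =
        CohenD.hedgesG (Finset.univ.filter fun i => X i 1 = 0)
          (Finset.univ.filter fun i => X i 1 = 1) y) := by
  have hlaw : HasLaw Y (CohenD.modelLaw X β σ) P := by
    have hshift : MeasurePreserving (fun e => WithLp.toLp 2 (X *ᵥ β) + e)
        (multivariateGaussian 0 (σ ^ 2 • (1 : Matrix (Fin n) (Fin n) ℝ)))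
        (CohenD.modelLaw X β σ) := by
      refine ⟨by fun_prop, ?_⟩
      rw [CohenD.modelLaw, multivariateGaussian_smul_one, multivariateGaussian_smul_one,
        Measure.map_map (by fun_prop) (by fun_prop)]
      simp only [Function.comp_def, zero_add]
    rw [show Y = fun ω => WithLp.toLp 2 (X *ᵥ β) + ε ω from funext hY]
    exact hshift.fun_comp_hasLaw hε
  have : IsProbabilityMeasure (CohenD.modelLaw X β σ) := by
    unfold CohenD.modelLaw
    infer_instance
  have := hlaw.isProbabilityMeasure
  have hmeas := CohenD.measurable_dHatU X
  obtain ⟨hL, hE, hV⟩ := CohenD.moments_dHatU hm hX β hσ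
  have hL' : MemLp (fun ω => CohenD.dHatU X (Y ω)) 2 P := by
    rw [← hlaw.map_eq, memLp_map_measure_iff hmeas.aestronglyMeasurable hlaw.aemeasurable] at hL
    exact hL
  refine ⟨⟨hL'.integrable one_le_two, ?_⟩, ⟨hL', ?_⟩, ?_, ?_⟩
  · rw [← hE]
    exact hlaw.integral_comp hmeas.aestronglyMeasurable
  · rw [← hV, ← hlaw.map_eq, variance_map hmeas.aemeasurable hlaw.aemeasurable]
    rfl
  · intro y β' σ' hσ' hy
    rw [(CohenD.moments_dHatU hm hX β' hσ').2.2, hy]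
  · rintro rfl h0 h1 y
    exact CohenD.dHatU_eq_hedgesG hX h0 h1 y
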